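/- Let $F$ be an algebraically closed field and let $V$ be a finite-dimensional vector space over $F$. Suppose that the characteristic of $F$ is either $0$ or greater than $\dim V$. Let $B : V \times V \to F$ be a non-degenerate bilinear form that is either symmetric or symplectic (that is, skew-symmetric: $B(v,w) = -B(w,v)$ for all $v,w$), and let $I(V,B)$ be its isometry group, the group of all $g \in GL(V)$ with $B(gv,gw)=B(v,w)$ for all $v,w\in V$. For a linear map $T : V \to V$, regard $V$ as an $F[x]$-module on which $x$ acts as $T$; it is isomorphic to a direct sum $\bigoplus_i F[x]/(p_i(x)^{k_i})$ with finitely many summands, where each $p_i$ is monic and irreducible and $k_i \ge 1$. The multiset of the prime powers $p_i(x)^{k_i}$, which is uniquely determined by $T$, is called the elementary divisors of $T$ (counted with multiplicity). Theorem. Let $S, T \in I(V,B)$. 1. $S$ and $T$ are conjugate in $I(V,B)$ if and only if they have the same elementary divisors. 2. $S$ and $T$ are conjugate in $I(V,B)$ if and only if they are conjugate in $GL(V)$. -/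

import Mathlib

open Polynomial
open scoped DirectSum

/-- The isometry group `I(V, B)`: all `g` in `GL(V)` with `B (g v) (g w) = B v w`. -/
def isometryGroup {F V : Type*} [Field F] [AddCommGroup V] [Module F V]
    (B : LinearMap.BilinForm F V) : Subgroup (V ≃ₗ[F] V) where
  carrier := {g | ∀ v w, B (g v) (g w) = B v w}
  one_mem' := fun _ _ => rfl
  mul_mem' := by
    intro a b ha hb v w
    change B (a (b v)) (a (b w)) = B v w
    rw [ha, hb]
  inv_mem' := by
    intro a ha v w
    have h := ha (a.symm v) (a.symm w)
    rw [LinearEquiv.apply_symm_apply, LinearEquiv.apply_symm_apply] at h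
    exact h.symm

/-- `HasElementaryDivisors T s`: for some `n`, monic irreducible `p₁, …, pₙ` and exponents
`kᵢ ≥ 1`, the `F[X]`-module on which `X` acts as `T` is isomorphic to the direct sum of the
cyclic modules `F[X] / (pᵢ ^ kᵢ)`, and `s` is the multiset of the `pᵢ ^ kᵢ`. -/
def HasElementaryDivisors {F V : Type*} [Field F] [AddCommGroup V] [Module F V]
    (T : Module.End F V) (s : Multiset F[X]) : Prop :=
  ∃ (n : ℕ) (p : Fin n → F[X]) (k : Fin n → ℕ),
    (∀ i, (p i).Monic ∧ Irreducible (p i) ∧ 1 ≤ k i) ∧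
    s = Finset.univ.val.map (fun i => p i ^ k i) ∧
    Nonempty (Module.AEval' T ≃ₗ[F[X]] ⨁ i, F[X] ⧸ Ideal.span {p i ^ k i})

/-- Every endomorphism of a finite-dimensional space has a primary cyclic decomposition. -/
theorem exists_hasElementaryDivisors {F V : Type*} [Field F] [AddCommGroup V] [Module F V]
    [FiniteDimensional F V] (T : Module.End F V) : ∃ s, HasElementaryDivisors T s := by
  classical
  have htors : Module.IsTorsion F[X] (Module.AEval' T) := by
    intro x
    refine ⟨⟨minpoly F T, mem_nonZeroDivisors_of_ne_zero
      (minpoly.ne_zero (Algebra.IsIntegral.isIntegral T))⟩, ?_⟩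
    apply (Module.AEval'.of T).symm.injective
    change (Module.AEval.of F V T).symm (minpoly F T • x) = _
    rw [Module.AEval.of_symm_smul, minpoly.aeval]
    simp
  obtain ⟨ι, hι, p, hp, e, ⟨f⟩⟩ := Module.equiv_directSum_of_isTorsion htors
  let κ := {i : ι // e i ≠ 0}
  let σ : Fin (Fintype.card κ) ≃ κ := (Fintype.equivFin κ).symm
  refine ⟨_, Fintype.card κ, fun j => normalize (p (σ j)), fun j => e (σ j), ?_, rfl, ?_⟩
  · intro j
    refine ⟨Polynomial.monic_normalize (hp _).ne_zero,
      (normalize_associated _).symm.irreducible (hp _), Nat.one_le_iff_ne_zero.2 (σ j).2⟩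
  · have hsub : ∀ i : ι, e i = 0 → Subsingleton (F[X] ⧸ Submodule.span F[X] {p i ^ e i}) := by
      intro i hi
      rw [hi, pow_zero]
      exact Ideal.Quotient.subsingleton_iff.2 Ideal.span_singleton_one
    let r : (∀ i : ι, F[X] ⧸ Submodule.span F[X] {p i ^ e i}) →ₗ[F[X]]
        (∀ j, F[X] ⧸ Submodule.span F[X] {p (σ j) ^ e (σ j)}) :=
      LinearMap.pi fun j => LinearMap.proj (σ j : ι)
    have hr : Function.Bijective r := by
      constructor
      · intro x y hxy
        funext i
        by_cases hi : e i = 0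
        · exact (hsub i hi).elim _ _
        · obtain ⟨j, hj⟩ := σ.surjective ⟨i, hi⟩
          have h := congrFun hxy j
          have hi' : (σ j : ι) = i := by rw [hj]
          subst hi'
          exact h
      · intro y
        let z : ∀ l : κ, F[X] ⧸ Submodule.span F[X] {p l ^ e l} :=
          (Equiv.piCongrLeft (fun l : κ => F[X] ⧸ Submodule.span F[X] {p l ^ e l}) σ) y
        refine ⟨fun i => if hi : e i ≠ 0 then z ⟨i, hi⟩ else 0, ?_⟩
        funext j
        change (if hi : e (σ j) ≠ 0 then z ⟨σ j, hi⟩ else 0) = y j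
        rw [dif_pos (σ j).2]
        exact Equiv.piCongrLeft_apply_apply
          (fun l : κ => F[X] ⧸ Submodule.span F[X] {p l ^ e l}) σ y j
    have hq : ∀ j, Submodule.span F[X] {p (σ j) ^ e (σ j)} =
        Ideal.span {normalize (p (σ j)) ^ e (σ j)} := fun j =>
      Ideal.span_singleton_eq_span_singleton.2 ((associated_normalize _).pow_pow)
    exact ⟨f ≪≫ₗ DirectSum.linearEquivFunOnFintype F[X] ι _ ≪≫ₗ LinearEquiv.ofBijective r hr ≪≫ₗ
      LinearEquiv.piCongrRight (fun j => Submodule.quotEquivOfEq _ _ (hq j)) ≪≫ₗ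
      (DirectSum.linearEquivFunOnFintype F[X] _ _).symm⟩

/-- The elementary divisors, counted with multiplicity, of an endomorphism `T` of a
finite-dimensional space. By the uniqueness part of the structure theorem for finitely generated
modules over a principal ideal domain there is exactly one `s` with `HasElementaryDivisors T s`,
so that the choice made here is immaterial. -/
noncomputable def elementaryDivisors {F V : Type*} [Field F] [AddCommGroup V] [Module F V]
    [FiniteDimensional F V] (T : Module.End F V) : Multiset F[X] :=
  (exists_hasElementaryDivisors T).choose

/-! The proof is a polar decomposition. Let `g * S * g⁻¹ = T` in GL(V), and let `A = g* g`, with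
`g*` the `B`-adjoint. Then `A` is invertible, self-adjoint for either symmetry type, and commutes
with `S`, since `S` and `T` are isometries. If 2 ≠ 0, `A` has a square root `r` that is a polynomial
in `A`, hence self-adjoint and commuting with `S`. So `g * r⁻¹` still conjugates `S` to `T`, and it
is an isometry because `B (g v) (g w) = B (r² v) w = B (r v) (r w)`.

The root exists because `X` is a square modulo the minimal polynomial of `A`: interpolate square
roots of the eigenvalues, then correct by Newton iteration. In GL(V), elementary divisors classify
conjugacy by the structure of `F[X]`-modules. -/

namespace Polynomial

/-- A polynomial over an algebraically closed field divides a power of every polynomial that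
vanishes at all of its roots. -/
theorem exists_dvd_pow_of_forall_isRoot {F : Type*} [Field F] [IsAlgClosed F] {m f : F[X]}
    (hm : m ≠ 0) (h : ∀ a, m.IsRoot a → f.IsRoot a) : ∃ n : ℕ, m ∣ f ^ n := by
  refine ⟨m.roots.card, ?_⟩
  have hprod : (m.roots.map fun a => X - C a).prod ∣ (m.roots.map fun _ => f).prod := by
    refine Multiset.prod_dvd_prod_of_dvd _ _ fun a ha => ?_
    exact dvd_iff_isRoot.2 (h a (isRoot_of_mem_roots ha))
  rw [Multiset.map_const', Multiset.prod_replicate] at hprod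
  have hu : IsUnit (C m.leadingCoeff) :=
    isUnit_C.2 (isUnit_iff_ne_zero.2 (leadingCoeff_ne_zero.2 hm))
  have h := hu.mul_left_dvd.2 hprod
  rwa [← (IsAlgClosed.splits m).eq_prod_roots] at h

/-- Over an algebraically closed field of characteristic other than two, `X` is a square modulo
every polynomial that does not vanish at zero. -/
theorem exists_dvd_sq_sub_X {F : Type*} [Field F] [IsAlgClosed F] (h2 : (2 : F) ≠ 0) {m : F[X]}
    (hm0 : m.eval 0 ≠ 0) : ∃ q : F[X], m ∣ q ^ 2 - X := by
  classical
  have hm : m ≠ 0 := by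
    rintro rfl
    exact hm0 eval_zero
  choose r hr using fun a : F => IsAlgClosed.exists_pow_nat_eq a (n := 2) two_pos
  -- `L` takes a square root of `a` as its value at each root `a` of `m`, so `L ^ 2 - X` is
  -- nilpotent modulo `m`.
  let L : F[X] := Lagrange.interpolate m.roots.toFinset id r
  have hL : ∀ a, m.IsRoot a → (L ^ 2 - X).IsRoot a := by
    intro a ha
    have hLa : L.eval a = r a :=
      Lagrange.eval_interpolate_at_node r (Set.injOn_id _)
        (Multiset.mem_toFinset.2 ((mem_roots hm).2 ha))
    simp [IsRoot, hLa, hr]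
  obtain ⟨n, hn⟩ := exists_dvd_pow_of_forall_isRoot hm hL
  have hnil : IsNilpotent (AdjoinRoot.mk m L ^ 2 - AdjoinRoot.root m) := by
    refine ⟨n, ?_⟩
    rw [← AdjoinRoot.mk_X, ← map_pow, ← map_sub, ← map_pow]
    exact AdjoinRoot.mk_eq_zero.2 hn
  have hroot : IsUnit (AdjoinRoot.root m) := by
    have hcop : IsCoprime (X : F[X]) m := by
      refine (irreducible_X.coprime_iff_not_dvd).2 fun hdvd => hm0 ?_
      rwa [X_dvd_iff, coeff_zero_eq_eval_zero] at hdvd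
    obtain ⟨a, b, hab⟩ := hcop
    refine IsUnit.of_mul_eq_one (AdjoinRoot.mk m a) ?_
    have h := congrArg (AdjoinRoot.mk m) hab
    rwa [map_add, map_mul, map_mul, AdjoinRoot.mk_self, mul_zero, add_zero, AdjoinRoot.mk_X,
      map_one, mul_comm] at h
  -- `L ^ 2` is the unit `X` plus a nilpotent.
  have hLu : IsUnit (AdjoinRoot.mk m L) := by
    have h := hnil.isUnit_add_left_of_commute hroot (Commute.all _ _)
    rw [add_sub_cancel] at h
    exact (isUnit_pow_iff two_ne_zero).1 h
  have h2u : IsUnit (2 : AdjoinRoot m) := by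
    have h := (isUnit_iff_ne_zero.2 h2).map (algebraMap F (AdjoinRoot m))
    rwa [map_ofNat] at h
  -- Newton's method for `Y ^ 2 - X` from `L`: the value is nilpotent and the derivative `2 * L` is
  -- a unit.
  obtain ⟨s, ⟨-, hs⟩, -⟩ := existsUnique_nilpotent_sub_and_aeval_eq_zero
    (P := (X ^ 2 - C (AdjoinRoot.root m) : (AdjoinRoot m)[X])) (x := AdjoinRoot.mk m L)
    (by simpa using hnil) (by simpa [one_add_one_eq_two] using h2u.mul hLu)
  obtain ⟨q, rfl⟩ := AdjoinRoot.mk_surjective s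
  refine ⟨q, AdjoinRoot.mk_eq_zero.1 ?_⟩
  simpa using hs

end Polynomial

/-- Over an algebraically closed field of characteristic other than two, an injective endomorphism
of a finite-dimensional space has a square root that is a polynomial in it. -/
theorem Module.End.exists_sq_aeval_eq {F V : Type*} [Field F] [IsAlgClosed F] [AddCommGroup V]
    [Module F V] [FiniteDimensional F V] (h2 : (2 : F) ≠ 0) (A : Module.End F V)
    (hA : Function.Injective A) : ∃ q : F[X], aeval A q ^ 2 = A := by
  have hm0 : (minpoly F A).eval 0 ≠ 0 := by
    intro h
    obtain ⟨v, hv⟩ := (Module.End.hasEigenvalue_of_isRoot h).exists_hasEigenvector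
    have hv0 : A v = A 0 := by rw [hv.apply_eq_smul, zero_smul, map_zero]
    exact hv.2 (hA hv0)
  obtain ⟨q, c, hc⟩ := Polynomial.exists_dvd_sq_sub_X h2 hm0
  refine ⟨q, ?_⟩
  have h := congrArg (aeval A) hc
  rw [map_mul, minpoly.aeval, zero_mul, map_sub, map_pow, aeval_X] at h
  exact sub_eq_zero.1 h

/-- A polynomial in an endomorphism that is self-adjoint for a bilinear form is self-adjoint. -/
theorem LinearMap.BilinForm.aeval_apply_left {R M : Type*} [CommRing R] [AddCommGroup M]
    [Module R M] (B : LinearMap.BilinForm R M) {A : Module.End R M}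
    (hA : ∀ v w, B (A v) w = B v (A w)) (q : R[X]) (v w : M) :
    B (aeval A q v) w = B v (aeval A q w) := by
  induction q using Polynomial.induction_on' generalizing v w with
  | add p q hp hq => simp [hp, hq]
  | monomial n a =>
    have hpow : ∀ n : ℕ, ∀ v w, B ((A ^ n) v) w = B v ((A ^ n) w) := by
      intro n
      induction n with
      | zero => simp
      | succ n ih =>
        intro v w
        rw [pow_succ', Module.End.mul_apply, hA, ih, ← Module.End.mul_apply, ← pow_succ,
          ← pow_succ']
    simp [aeval_monomial, hpow]

/-- Isometries of a non-degenerate symmetric or skew-symmetric form over an algebraically closed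
field of characteristic other than two that are conjugate in `GL(V)` are conjugate in the isometry
group: the polar decomposition of the conjugating map replaces it by an isometry. -/
theorem isometryGroup.isConj_of_isConj {F V : Type*} [Field F] [IsAlgClosed F] [AddCommGroup V]
    [Module F V] [FiniteDimensional F V] (h2 : (2 : F) ≠ 0)
    {B : LinearMap.BilinForm F V} (hB : B.Nondegenerate)
    (hsymm : (∀ v w, B v w = B w v) ∨ (∀ v w, B v w = - B w v))
    {S T : isometryGroup B} (h : IsConj (S : V ≃ₗ[F] V) (T : V ≃ₗ[F] V)) : IsConj S T := by
  obtain ⟨⟨S, hS⟩, ⟨T, hT⟩⟩ := S, T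
  obtain ⟨g, hg⟩ := isConj_iff.1 h
  have hgS : ∀ v, g (S v) = T (g v) := fun v => LinearEquiv.congr_fun (mul_inv_eq_iff_eq_mul.1 hg) v
  let A : Module.End F V :=
    LinearMap.BilinForm.symmCompOfNondegenerate (B.compl₁₂ g.toLinearMap g.toLinearMap) B hB
  have hA : ∀ v w, B (A v) w = B (g v) (g w) := fun v w =>
    LinearMap.BilinForm.symmCompOfNondegenerate_left_apply _ hB w v
  have hAadj : ∀ v w, B (A v) w = B v (A w) := by
    intro v w
    rcases hsymm with hs | hs
    · rw [hA, hs v, hA, hs]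
    · rw [hA, hs v, hA, hs]
  have hAinj : Function.Injective A := by
    refine (injective_iff_map_eq_zero A).2 fun v hv => ?_
    refine g.map_eq_zero_iff.1 (hB.1 _ fun w => ?_)
    rw [← g.apply_symm_apply w, ← hA, hv, map_zero, LinearMap.zero_apply]
  -- Tested against vectors `S w`: `B (A (S v)) (S w) = B (T (g v)) (T (g w)) = B (A v) w = B (S (A
  -- v)) (S w)`.
  have hAS : Commute A (S : Module.End F V) := by
    ext v
    refine sub_eq_zero.1 (hB.1 _ fun w => ?_)
    rw [← S.apply_symm_apply w]
    change B (A (S v) - S (A v)) (S (S.symm w)) = 0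
    rw [map_sub, LinearMap.sub_apply, hA, hgS, hgS, hT, hS, hA, sub_self]
  obtain ⟨q, hq⟩ := A.exists_sq_aeval_eq h2 hAinj
  have hq' : ∀ v, aeval A q (aeval A q v) = A v := fun v => by
    rw [← Module.End.mul_apply, ← sq, hq]
  have hqinj : Function.Injective (aeval A q) := by
    refine (injective_iff_map_eq_zero _).2 fun v hv => ?_
    refine (injective_iff_map_eq_zero A).1 hAinj v ?_
    rw [← hq', hv, map_zero]
  let r : V ≃ₗ[F] V := LinearEquiv.ofInjectiveEndo (aeval A q) hqinj
  have hr : ∀ v, r v = aeval A q v := fun _ => rfl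
  have hrS : r * S = S * r := by
    ext v
    exact LinearMap.congr_fun (Algebra.commute_of_mem_adjoin_singleton_of_commute
      (aeval_mem_adjoin_singleton F A) hAS.symm).eq.symm v
  have hu : g * r⁻¹ ∈ isometryGroup B := by
    intro v w
    obtain ⟨v, rfl⟩ := r.surjective v
    obtain ⟨w, rfl⟩ := r.surjective w
    change B (g (r.symm (r v))) (g (r.symm (r w))) = B (r v) (r w)
    rw [r.symm_apply_apply, r.symm_apply_apply, hr, hr, ← B.aeval_apply_left hAadj, hq', hA]
  refine isConj_iff.2 ⟨⟨g * r⁻¹, hu⟩, Subtype.ext ?_⟩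
  change g * r⁻¹ * S * (g * r⁻¹)⁻¹ = T
  have hrS' : r⁻¹ * S = S * r⁻¹ := by
    rw [inv_mul_eq_iff_eq_mul, ← mul_assoc, hrS, mul_inv_cancel_right]
  change g * S * g⁻¹ = T at hg
  rw [mul_assoc g, hrS', ← hg]
  group

/-- Conjugate automorphisms have the same elementary divisors. -/
theorem IsConj.hasElementaryDivisors {F V : Type*} [Field F] [AddCommGroup V] [Module F V]
    {S T : V ≃ₗ[F] V} (h : IsConj S T) {s : Multiset F[X]}
    (hS : HasElementaryDivisors (S : Module.End F V) s) :
    HasElementaryDivisors (T : Module.End F V) s := by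
  obtain ⟨g, hg⟩ := isConj_iff.1 h.symm
  obtain ⟨n, p, k, hpk, hs, ⟨e⟩⟩ := hS
  refine ⟨n, p, k, hpk, hs, ⟨LinearEquiv.ofAEval (T : Module.End F V)
    (g ≪≫ₗ Module.AEval'.of (S : Module.End F V)) (fun v => ?_) ≪≫ₗ e⟩⟩
  have hv : g (T v) = S (g v) := LinearEquiv.congr_fun (mul_inv_eq_iff_eq_mul.1 hg) v
  change Module.AEval'.of (S : Module.End F V) (g (T v)) = _
  rw [hv]
  exact (Module.AEval'.X_smul_of (S : Module.End F V) (g v)).symm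

/-- Automorphisms with the same elementary divisors are conjugate. -/
theorem HasElementaryDivisors.isConj {F V : Type*} [Field F] [AddCommGroup V] [Module F V]
    {S T : V ≃ₗ[F] V} {s : Multiset F[X]} (hS : HasElementaryDivisors (S : Module.End F V) s)
    (hT : HasElementaryDivisors (T : Module.End F V) s) : IsConj S T := by
  obtain ⟨n, p, k, -, hs, ⟨e⟩⟩ := hS
  obtain ⟨n', p', k', -, hs', ⟨e'⟩⟩ := hT
  obtain ⟨σ, hσ⟩ : ∃ σ : Fin n' ≃ Fin n, ∀ i, p (σ i) ^ k (σ i) = p' i ^ k' i := by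
    classical
    -- Equal multiplicities make the fibres of the two families equinumerous, which gives the
    -- reindexing `σ`.
    have hcard : ∀ a : F[X], Fintype.card {i // p' i ^ k' i = a} =
        Fintype.card {i // p i ^ k i = a} := by
      intro a
      have hcount := congrArg (Multiset.count a) (hs.symm.trans hs')
      rw [Multiset.count_map, Multiset.count_map] at hcount
      rw [Fintype.card_subtype, Fintype.card_subtype]
      simpa [Finset.card_def, eq_comm] using hcount.symm
    refine ⟨Equiv.ofFiberEquiv fun a => Fintype.equivOfCardEq (hcard a), fun i => ?_⟩
    exact Equiv.ofFiberEquiv_map (g := fun i => p i ^ k i) _ i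
  let c : (∀ i, F[X] ⧸ Ideal.span {p i ^ k i}) ≃ₗ[F[X]] ∀ i, F[X] ⧸ Ideal.span {p' i ^ k' i} :=
    (LinearEquiv.piCongrLeft F[X] (fun i => F[X] ⧸ Ideal.span {p i ^ k i}) σ).symm ≪≫ₗ
      LinearEquiv.piCongrRight fun i =>
        Submodule.quotEquivOfEq _ _ (congrArg (fun a => Ideal.span {a}) (hσ i))
  let f : Module.AEval' (S : Module.End F V) ≃ₗ[F[X]] Module.AEval' (T : Module.End F V) :=
    e ≪≫ₗ DirectSum.linearEquivFunOnFintype F[X] _ _ ≪≫ₗ c ≪≫ₗ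
      (DirectSum.linearEquivFunOnFintype F[X] _ _).symm ≪≫ₗ e'.symm
  let g : V ≃ₗ[F] V := Module.AEval'.of (S : Module.End F V) ≪≫ₗ f.restrictScalars F ≪≫ₗ
    (Module.AEval'.of (T : Module.End F V)).symm
  refine isConj_iff.2 ⟨g, mul_inv_eq_iff_eq_mul.2 (LinearEquiv.ext fun v => ?_)⟩
  change (Module.AEval'.of (T : Module.End F V)).symm
      (f (Module.AEval'.of (S : Module.End F V) ((S : Module.End F V) v))) = _
  rw [← Module.AEval'.X_smul_of, map_smul, Module.AEval'.of_symm_X_smul]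
  rfl

/-- Automorphisms of a finite-dimensional space are conjugate if and only if they have the same
elementary divisors. -/
theorem isConj_iff_elementaryDivisors_eq {F V : Type*} [Field F] [AddCommGroup V] [Module F V]
    [FiniteDimensional F V] {S T : V ≃ₗ[F] V} :
    IsConj S T ↔
      elementaryDivisors (S : Module.End F V) = elementaryDivisors (T : Module.End F V) := by
  refine ⟨fun h => ?_, fun h => ?_⟩
  · have hST : HasElementaryDivisors (S : Module.End F V) =
        HasElementaryDivisors (T : Module.End F V) :=
      funext fun s => propext ⟨h.hasElementaryDivisors, h.symm.hasElementaryDivisors⟩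
    unfold elementaryDivisors
    congr
  · have hS : HasElementaryDivisors (S : Module.End F V) (elementaryDivisors _) :=
      (exists_hasElementaryDivisors _).choose_spec
    have hT : HasElementaryDivisors (T : Module.End F V) (elementaryDivisors _) :=
      (exists_hasElementaryDivisors _).choose_spec
    exact hS.isConj (h ▸ hT)

/-- Conjugate automorphisms of a space of dimension at most one are equal. -/
theorem LinearEquiv.eq_of_isConj_of_finrank_le_one {F V : Type*} [Field F] [AddCommGroup V]
    [Module F V] [FiniteDimensional F V] (h1 : Module.finrank F V ≤ 1) {S T : V ≃ₗ[F] V}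
    (h : IsConj S T) : S = T := by
  obtain ⟨g, rfl⟩ := isConj_iff.1 h
  -- All vectors are multiples of `v`, so `S` and `g` act as scalars and commute.
  obtain ⟨v, hv⟩ := finrank_le_one_iff.1 h1
  refine eq_mul_inv_of_mul_eq (LinearEquiv.ext fun w => ?_)
  obtain ⟨a, ha⟩ := hv (S v)
  obtain ⟨b, hb⟩ := hv (g v)
  obtain ⟨c, rfl⟩ := hv w
  change S (g (c • v)) = g (S (c • v))
  simp only [map_smul, ← ha, ← hb, smul_comm a b]

theorem mainTheorem1 {F V : Type*} [Field F] [IsAlgClosed F] [AddCommGroup V] [Module F V]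
    [FiniteDimensional F V]
    (hchar : ringChar F = 0 ∨ Module.finrank F V < ringChar F)
    (B : LinearMap.BilinForm F V) (hB : B.Nondegenerate)
    (hsymm : (∀ v w, B v w = B w v) ∨ (∀ v w, B v w = - B w v))
    (S T : isometryGroup B) :
    (IsConj S T ↔
      elementaryDivisors ((S : V ≃ₗ[F] V) : Module.End F V) =
        elementaryDivisors ((T : V ≃ₗ[F] V) : Module.End F V)) ∧
    (IsConj S T ↔ IsConj (S : V ≃ₗ[F] V) (T : V ≃ₗ[F] V)) := by
  have key : IsConj S T ↔ IsConj (S : V ≃ₗ[F] V) (T : V ≃ₗ[F] V) := by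
    refine ⟨fun h => (isometryGroup B).subtype.map_isConj h, fun h => ?_⟩
    -- Characteristic 2 forces dimension at most 1, where conjugate maps are equal.
    by_cases h2 : (2 : F) = 0
    · have hdvd : ringChar F ∣ 2 := (ringChar.spec F 2).1 (by exact_mod_cast h2)
      have hle := Nat.le_of_dvd two_pos hdvd
      have h0 : ringChar F ≠ 0 := by
        intro h0
        rw [h0] at hdvd
        exact two_ne_zero (zero_dvd_iff.1 hdvd)
      have h1 : Module.finrank F V ≤ 1 := by omega
      exact (Subtype.ext (LinearEquiv.eq_of_isConj_of_finrank_le_one h1 h)) ▸ IsConj.refl S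
    · exact isometryGroup.isConj_of_isConj h2 hB hsymm h
  exact ⟨key.trans isConj_iff_elementaryDivisors_eq, key⟩
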